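/- Notation. Let $\mathbb{I}=[0,1]$ and $d\ge 3$. A $d$-dimensional copula is a function $C:\mathbb{I}^d\to\mathbb{I}$ for which there is a (necessarily unique) Borel probability measure $\mu_C$ on $\mathbb{I}^d$ with uniform one-dimensional marginals and $\mu_C([\mathbf{0},\mathbf{x}])=C(\mathbf{x})$ for all $\mathbf{x}\in\mathbb{I}^d$. An Archimedean generator is a continuous, non-increasing function $\psi:[0,\infty)\to\mathbb{I}$ with $\psi(0)=1$ and $\lim_{z\to\infty}\psi(z)=0=:\psi(\infty)$ that is strictly decreasing on $[0,\inf\{z\in[0,\infty]:\psi(z)=0\}]$, normalized by $\psi(1)=\tfrac12$; its pseudo-inverse is $\varphi(y)=\inf\{z\in[0,\infty]:\psi(z)=y\}$, $y\in\mathbb{I}$. A copula $C$ is Archimedean if there is such a $\psi$ with $C(\mathbf{x})=\psi(\varphi(x_1)+\cdots+\varphi(x_d))$ for all $\mathbf{x}\in\mathbb{I}^d$. Let $\mu_{C^{1:d-1}}$ be the law of the first $d-1$ coordinates under $\mu_C$, and let $K_C(\mathbf{x},\cdot)$ be (a version of) the regular conditional distribution, under $\mu_C$, of the last coordinate given that the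 first $d-1$ coordinates equal $\mathbf{x}\in\mathbb{I}^{d-1}$. For $t\in\mathbb{I}$ let $L_t=\{\mathbf{u}\in\mathbb{I}^d: C(\mathbf{u})=t\}$ be the level sets of $C$, and let $F_K^d(t)=\mu_C(\{\mathbf{u}\in\mathbb{I}^d:C(\mathbf{u})\le t\})$ be its Kendall distribution function. A function $F$ on $\mathbb{I}$ is called a step function if $F(y)=\sum_{j:\,a_j\le y}w_j$ for all $y\in\mathbb{I}$, with countably many jump points $a_j\in\mathbb{I}$ (possibly dense) and summable weights $w_j\ge 0$. Theorem. For every $d\ge3$ there exists a $d$-dimensional Archimedean copula $C$ with the following properties: (1) $\mu_C$ is singular with respect to Lebesgue measure on $\mathbb{I}^d$, has no point masses, and has full support $\mathbb{I}^d$. (2) For $\mu_{C^{1:d-1}}$-almost every $\mathbf{x}\in\mathbb{I}^{d-1}$ the conditional distribution function $y\mapsto K_C(\mathbf{x},[0,y])$ is a strictly increasing step function (for every version of $K_C$). (3) There exists a countable dense subset $\mathcal{Q}$ of $(0,1)$ such that, for every $t\in\mathbb{I}$, $\mu_C(L_t)>0$ if and only if $t\in\mathcal{Q}$. (4) The Kendall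 distribution function $F_K^d$ is a strictly increasing step function. -/

import Mathlib

open MeasureTheory ProbabilityTheory Set Filter Topology
open scoped NNReal ENNReal unitInterval

/-- `μ` is a `d`-stochastic measure: a probability measure on `[0,1]^d` all of whose
one-dimensional marginals are Lebesgue measure on `[0,1]`. -/
def IsStochasticMeasure {d : ℕ} (μ : Measure (Fin d → I)) : Prop :=
  IsProbabilityMeasure μ ∧ ∀ i, μ.map (fun x => x i) = (volume : Measure I)

/-- `C` is a `d`-dimensional copula with corresponding `d`-stochastic measure `μ`, that is,
`μ [0, x] = C x` for all `x`. Given `C`, such a `μ` is unique. -/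
def IsCopulaWithMeasure {d : ℕ} (C : (Fin d → I) → I) (μ : Measure (Fin d → I)) : Prop :=
  IsStochasticMeasure μ ∧ ∀ x, μ (Iic x) = ENNReal.ofReal (C x : ℝ)

/-- The extension of `ψ : [0,∞) → [0,1]` to `[0,∞]` by `ψ ∞ = 0`. -/
noncomputable def extendGenerator (ψ : ℝ≥0 → I) (z : ℝ≥0∞) : I :=
  if z = ⊤ then 0 else ψ z.toNNReal

/-- The pseudo-inverse `φ y = inf {z ∈ [0,∞] : ψ z = y}`. -/
noncomputable def pseudoInverse (ψ : ℝ≥0 → I) (y : I) : ℝ≥0∞ :=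
  sInf {z : ℝ≥0∞ | extendGenerator ψ z = y}

/-- (Normalized) Archimedean generators. -/
structure IsArchimedeanGenerator (ψ : ℝ≥0 → I) : Prop where
  continuous : Continuous ψ
  antitone : Antitone ψ
  map_zero : ψ 0 = 1
  tendsto_zero : Tendsto ψ atTop (𝓝 0)
  /-- strictly decreasing on `[0, inf {z ∈ [0,∞] : ψ z = 0}]` -/
  strictAntiOn : StrictAntiOn (extendGenerator ψ)
    (Iic (sInf {z : ℝ≥0∞ | extendGenerator ψ z = 0}))
  /-- the normalization `ψ 1 = 1/2` -/
  normalized : (ψ 1 : ℝ) = 1 / 2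

/-- `C_ψ x = ψ (φ x₁ + ⋯ + φ x_d)`. -/
noncomputable def archimedeanFunction {d : ℕ} (ψ : ℝ≥0 → I) (x : Fin d → I) : I :=
  extendGenerator ψ (∑ i, pseudoInverse ψ (x i))

/-- `C` is a `d`-dimensional Archimedean copula, with corresponding `d`-stochastic measure `μ`. -/
def IsArchimedeanCopulaWithMeasure {d : ℕ} (C : (Fin d → I) → I)
    (μ : Measure (Fin d → I)) : Prop :=
  IsCopulaWithMeasure C μ ∧ ∃ ψ : ℝ≥0 → I, IsArchimedeanGenerator ψ ∧ C = archimedeanFunction ψ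

/-- The law of the first `n` of `n + 1` coordinates; if `μ` is the measure of the copula `C`,
this is the measure of the marginal copula `C^{1:n}`. -/
noncomputable def firstMarginal {n : ℕ} (μ : Measure (Fin (n + 1) → I)) : Measure (Fin n → I) :=
  μ.map (fun x => Fin.init x)

/-- `K` is (a version of) the `n`-Markov kernel of `μ`, i.e. the regular conditional distribution
of the last coordinate given the first `n` coordinates, expressed by disintegration. -/
def IsMarkovKernelOf {n : ℕ} (K : Kernel (Fin n → I) I) (μ : Measure (Fin (n + 1) → I)) : Prop :=
  IsMarkovKernel K ∧
    μ.map (fun x => ((Fin.init x : Fin n → I), x (Fin.last n))) = (firstMarginal μ) ⊗ₘ K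

/-- The `t`-level set of `C`. -/
def levelSet {d : ℕ} (C : (Fin d → I) → I) (t : I) : Set (Fin d → I) := {x | C x = t}

/-- The Kendall distribution function `t ↦ μ {x : C x ≤ t}` of a copula `C` with measure `μ`. -/
noncomputable def kendallFunction {d : ℕ} (C : (Fin d → I) → I) (μ : Measure (Fin d → I))
    (t : I) : ℝ :=
  μ.real {x | C x ≤ t}

/-- A (right-continuous, non-decreasing) step function in the sense of a pure jump function:
`F y = ∑_{j : a_j ≤ y} w_j` for countably many jump points `a_j` and weights `w_j ≥ 0`.
The jump points may be dense. -/
def IsStepFunction (F : I → ℝ) : Prop :=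
  ∃ (a : ℕ → I) (w : ℕ → ℝ), (∀ j, 0 ≤ w j) ∧
    ∀ y, HasSum (fun j => (Ici (a j)).indicator (fun _ => w j) y) (F y)

/-! Let `d = n + 1`. A generator ψ(z) = ∑ⱼ cⱼ (rⱼ - z)₊ⁿ is the Williamson transform of a discrete
radius R with P(R = rⱼ) = cⱼ rⱼⁿ, and its Archimedean copula is the law of (ψ(R S₁), …, ψ(R S_d))
with S uniform on the standard simplex and independent of R. The radii rⱼ are taken dense in (0, ∞);
all the claims are then read off from this representation.

Since ψ decreases, the event that the coordinates are at most ψ(z₁), …, ψ(z_d) says that the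
barycentric coordinates are at least z₁, …, z_d. On the simplex of size rⱼ this cuts out a smaller
simplex of mass cⱼ (rⱼ - ∑ zᵢ)₊ⁿ, and summation gives ψ(∑ zᵢ), which is the copula (`law_Iic`).

On the image of the j-th simplex the copula is constantly ψ(rⱼ). So its value has a discrete law
with dense atoms (`map_copula_law`), which settles level sets and the Kendall function. The measure
lives on countably many Lebesgue-null level sets, hence is singular; density of the radii gives full
support.

Projected to the first n barycentric coordinates, the j-th piece has constant density proportional
to cⱼ on {x ≥ 0, ∑ x ≤ rⱼ}. Given these coordinates with sum s, R is therefore some rⱼ ≥ s with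
probability proportional to cⱼ, and the last coordinate is ψ(R - s): again discrete with dense atoms
(`isMarkovKernelOf_lastKernel`). -/

/-! ### Volumes of corner simplices -/

/-- The corner simplex `{x ≥ 0, ∑ x ≤ s}` in `ℝⁿ`. -/
def cornerSimplex (n : ℕ) (s : ℝ) : Set (Fin n → ℝ) := {x | (∀ i, 0 ≤ x i) ∧ ∑ i, x i ≤ s}

theorem isClosed_cornerSimplex (n : ℕ) (s : ℝ) : IsClosed (cornerSimplex n s) := by
  have h : cornerSimplex n s = (⋂ i, {x | 0 ≤ x i}) ∩ {x | ∑ i, x i ≤ s} := by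
    ext x; simp [cornerSimplex]
  rw [h]
  refine (isClosed_iInter fun i => ?_).inter ?_
  · exact isClosed_le continuous_const (continuous_apply i)
  · exact isClosed_le (by fun_prop) continuous_const

theorem measurableSet_cornerSimplex (n : ℕ) (s : ℝ) : MeasurableSet (cornerSimplex n s) :=
  (isClosed_cornerSimplex n s).measurableSet

theorem volume_cornerSimplex_ne_top (n : ℕ) : volume (cornerSimplex n 1) ≠ ⊤ := by
  refine ((measure_mono (t := Icc 0 1) ?_).trans_lt isCompact_Icc.measure_lt_top).ne
  intro x hx
  refine ⟨fun i => hx.1 i, fun i => ?_⟩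
  exact (Finset.single_le_sum (f := x) (fun i _ => hx.1 i) (Finset.mem_univ i)).trans hx.2

theorem volume_cornerSimplex_ne_zero (n : ℕ) : volume (cornerSimplex n 1) ≠ 0 := by
  have ho : IsOpen ((⋂ i, {x : Fin n → ℝ | 0 < x i}) ∩ {x | ∑ i, x i < 1}) := by
    refine (isOpen_iInter_of_finite fun i => ?_).inter ?_
    · exact isOpen_lt continuous_const (continuous_apply i)
    · exact isOpen_lt (by fun_prop) continuous_const
  have hne : ((⋂ i, {x : Fin n → ℝ | 0 < x i}) ∩ {x | ∑ i, x i < 1}).Nonempty := by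
    refine ⟨fun _ => 1 / (n + 1), ?_, ?_⟩
    · simp only [mem_iInter, mem_ofPred_eq]
      intro _; positivity
    · simp only [mem_ofPred_eq, Finset.sum_const, Finset.card_univ, Fintype.card_fin, nsmul_eq_mul]
      rw [mul_one_div, div_lt_one (by positivity)]
      linarith
  refine ((ho.measure_pos volume hne).trans_le (measure_mono ?_)).ne'
  rintro x ⟨hx, hx'⟩
  simp only [mem_iInter, mem_ofPred_eq] at hx
  exact ⟨fun i => (hx i).le, le_of_lt hx'⟩

/-- Lebesgue measure on `ℝⁿ`, normalized so that the standard corner simplex has mass one. -/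
noncomputable def simplexMeasure (n : ℕ) : Measure (Fin n → ℝ) :=
  (volume (cornerSimplex n 1))⁻¹ • volume

theorem simplexMeasure_apply {n : ℕ} (s : Set (Fin n → ℝ)) :
    simplexMeasure n s = (volume (cornerSimplex n 1))⁻¹ * volume s := by
  simp [simplexMeasure]

theorem IsOpen.simplexMeasure_pos {n : ℕ} {s : Set (Fin n → ℝ)} (hs : IsOpen s)
    (hne : s.Nonempty) : 0 < simplexMeasure n s := by
  rw [simplexMeasure_apply]
  exact ENNReal.mul_pos (ENNReal.inv_ne_zero.2 (volume_cornerSimplex_ne_top n))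
    (hs.measure_pos volume hne).ne'

open scoped Pointwise in
-- Translating by `a` gives a corner simplex of size `s - ∑ aᵢ`, and volume scales with the n-th
-- power of the size. This is the source of the truncated powers in ψ.
theorem simplexMeasure_shifted {n : ℕ} (hn : n ≠ 0) (a : Fin n → ℝ) (s : ℝ) :
    simplexMeasure n {x | (∀ i, a i ≤ x i) ∧ ∑ i, x i ≤ s} =
      ENNReal.ofReal ((max (s - ∑ i, a i) 0) ^ n) := by
  have hshift : volume {x : Fin n → ℝ | (∀ i, a i ≤ x i) ∧ ∑ i, x i ≤ s} =
      volume (cornerSimplex n (s - ∑ i, a i)) := by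
    rw [← measure_preimage_add volume a {x : Fin n → ℝ | (∀ i, a i ≤ x i) ∧ ∑ i, x i ≤ s}]
    congr 1
    ext x
    simp only [cornerSimplex, mem_preimage, mem_ofPred_eq, Pi.add_apply, le_add_iff_nonneg_right,
      Finset.sum_add_distrib]
    rw [le_sub_iff_add_le']
  rw [simplexMeasure_apply, hshift]
  set h := s - ∑ i, a i
  rcases le_or_gt h 0 with h0 | h0
  · rw [max_eq_right h0, zero_pow hn, ENNReal.ofReal_zero]
    have hsub : cornerSimplex n h ⊆ {0} := by
      intro x hx
      have h1 : ∑ i, x i = 0 := le_antisymm (hx.2.trans h0) (Finset.sum_nonneg fun i _ => hx.1 i)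
      ext i
      exact (Finset.sum_eq_zero_iff_of_nonneg fun i _ => hx.1 i).1 h1 i (Finset.mem_univ i)
    have : Nonempty (Fin n) := ⟨⟨0, Nat.pos_of_ne_zero hn⟩⟩
    rw [measure_mono_null hsub (measure_singleton _), mul_zero]
  · have : cornerSimplex n h = h • cornerSimplex n 1 := by
      ext x
      rw [mem_smul_set_iff_inv_smul_mem₀ h0.ne']
      simp only [cornerSimplex, mem_ofPred_eq, Pi.smul_apply, smul_eq_mul, ← Finset.mul_sum]
      refine and_congr (forall_congr' fun i => ?_) ?_
      · rw [mul_nonneg_iff_of_pos_left (inv_pos.2 h0)]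
      · rw [inv_mul_le_iff₀ h0, mul_one]
    rw [this, Measure.addHaar_smul, Module.finrank_fin_fun, mul_left_comm,
      ENNReal.inv_mul_cancel (volume_cornerSimplex_ne_zero n) (volume_cornerSimplex_ne_top n),
      mul_one, max_eq_left h0.le, abs_of_nonneg (by positivity)]

theorem simplexMeasure_cornerSimplex {n : ℕ} (hn : n ≠ 0) {s : ℝ} (hs : 0 ≤ s) :
    simplexMeasure n (cornerSimplex n s) = ENNReal.ofReal (s ^ n) := by
  have := simplexMeasure_shifted hn 0 s
  simpa [cornerSimplex, hs] using this

/-! ### Sums of truncated powers -/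

/-- The function `z ↦ ∑ⱼ cⱼ (rⱼ - z)₊ⁿ`. -/
noncomputable def truncatedPowerSum (n : ℕ) (r c : ℕ → ℝ) (z : ℝ) : ℝ :=
  ∑' j, c j * (max (r j - z) 0) ^ n

section truncatedPowerSum

variable {n : ℕ} {r c : ℕ → ℝ}

theorem truncatedPower_le (hr : ∀ j, 0 < r j) {z : ℝ} (hz : 0 ≤ z) (j : ℕ) :
    (max (r j - z) 0) ^ n ≤ r j ^ n :=
  pow_le_pow_left₀ (le_max_right _ _) (max_le (by linarith) (hr j).le) n

theorem summable_truncatedPower (hr : ∀ j, 0 < r j) (hc : ∀ j, 0 < c j)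
    (hs : Summable fun j => c j * r j ^ n) {z : ℝ} (hz : 0 ≤ z) :
    Summable fun j => c j * (max (r j - z) 0) ^ n :=
  hs.of_nonneg_of_le (fun j => mul_nonneg (hc j).le (by positivity))
    fun j => mul_le_mul_of_nonneg_left (truncatedPower_le hr hz j) (hc j).le

theorem continuous_truncatedPowerSum_max (hr : ∀ j, 0 < r j) (hc : ∀ j, 0 < c j)
    (hs : Summable fun j => c j * r j ^ n) :
    Continuous fun z => truncatedPowerSum n r c (max z 0) := by
  refine continuous_tsum (fun j => by fun_prop) hs fun j z => ?_
  rw [Real.norm_of_nonneg (mul_nonneg (hc j).le (by positivity))]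
  exact mul_le_mul_of_nonneg_left (truncatedPower_le hr (le_max_right _ _) j) (hc j).le

theorem tendsto_truncatedPowerSum (hn : n ≠ 0) (hr : ∀ j, 0 < r j) (hc : ∀ j, 0 < c j)
    (hs : Summable fun j => c j * r j ^ n) :
    Tendsto (truncatedPowerSum n r c) atTop (𝓝 0) := by
  have : Tendsto (truncatedPowerSum n r c) atTop (𝓝 (∑' _ : ℕ, (0 : ℝ))) := by
    refine tendsto_tsum_of_dominated_convergence hs (fun j => ?_) ?_
    · refine tendsto_const_nhds.congr' ?_
      filter_upwards [eventually_ge_atTop (r j)] with z hz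
      rw [max_eq_right (by linarith), zero_pow hn, mul_zero]
    · filter_upwards [eventually_ge_atTop 0] with z hz j
      rw [Real.norm_of_nonneg (mul_nonneg (hc j).le (by positivity))]
      exact mul_le_mul_of_nonneg_left (truncatedPower_le hr hz j) (hc j).le
  simpa using this

/-- No term increases, and a term with `r j > z` strictly drops; unbounded radii provide one for
every `z`. -/
theorem truncatedPowerSum_strictAntiOn (hn : n ≠ 0) (hr : ∀ j, 0 < r j) (hc : ∀ j, 0 < c j)
    (hs : Summable fun j => c j * r j ^ n) (hunb : ∀ z, ∃ j, z < r j) :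
    StrictAntiOn (truncatedPowerSum n r c) (Ici 0) := by
  intro z hz w hw hzw
  obtain ⟨j, hj⟩ := hunb z
  refine Summable.tsum_lt_tsum (i := j) (fun k => ?_) ?_ (summable_truncatedPower hr hc hs hw)
    (summable_truncatedPower hr hc hs hz)
  · exact mul_le_mul_of_nonneg_left (pow_le_pow_left₀ (le_max_right _ _)
      (max_le_max (by linarith) le_rfl) n) (hc k).le
  · refine mul_lt_mul_of_pos_left (pow_lt_pow_left₀ ?_ (le_max_right _ _) hn) (hc j)
    rw [max_eq_left (by linarith : 0 ≤ r j - z)]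
    exact max_lt (by linarith) (by linarith)

end truncatedPowerSum

/-! ### Existence of normalized dense atoms -/

/-- Atoms `rⱼ`, dense in `(0, ∞)`, with weights `cⱼ`, normalized such that
`ψ z = ∑ⱼ cⱼ (rⱼ - z)₊ⁿ` satisfies `ψ 0 = 1` and `ψ 1 = 1 / 2`. -/
structure DenseAtoms (n : ℕ) where
  r : ℕ → ℝ
  c : ℕ → ℝ
  r_pos : ∀ j, 0 < r j
  c_pos : ∀ j, 0 < c j
  dense : ∀ a b, 0 ≤ a → a < b → ∃ j, a < r j ∧ r j < b
  summable_c : Summable c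
  hasSum_one : HasSum (fun j => c j * r j ^ n) 1
  hasSum_half : HasSum (fun j => c j * (max (r j - 1) 0) ^ n) (1 / 2)

theorem nonempty_denseAtoms {n : ℕ} (hn : n ≠ 0) : Nonempty (DenseAtoms n) := by
  obtain ⟨e, he⟩ := exists_surjective_nat {q : ℚ // 0 < q}
  let r : ℕ → ℝ := fun j => ((e j : ℚ) : ℝ)
  have hr : ∀ j, 0 < r j := fun j => Rat.cast_pos.2 (e j).2
  have hdense : ∀ a b, 0 ≤ a → a < b → ∃ j, a < r j ∧ r j < b := by
    intro a b ha hab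
    obtain ⟨q, hq1, hq2⟩ := exists_rat_btwn hab
    obtain ⟨j, hj⟩ := he ⟨q, by exact_mod_cast ha.trans_lt hq1⟩
    exact ⟨j, by simpa [r, hj] using hq1, by simpa [r, hj] using hq2⟩
  -- The denominator makes both `b j` and `b j * r j ^ n` summable, being dominated by a geometric
  -- series.
  let b : ℕ → ℝ := fun j => (1 / 2) ^ j / (1 + r j ^ n)
  have hb : ∀ j, 0 < b j := fun j => by have := hr j; positivity
  have hbs : Summable b := by
    refine summable_geometric_two.of_nonneg_of_le (fun j => (hb j).le) fun j => ?_
    have := hr j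
    exact div_le_self (by positivity) (by linarith [pow_pos this n])
  have hbr : Summable fun j => b j * r j ^ n := by
    refine summable_geometric_two.of_nonneg_of_le
      (fun j => mul_nonneg (hb j).le (pow_pos (hr j) n).le) fun j => ?_
    have := pow_pos (hr j) n
    rw [div_mul_eq_mul_div, div_le_iff₀ (by positivity)]
    exact mul_le_mul_of_nonneg_left (by linarith) (by positivity)
  let S : ℝ := ∑' j, b j * r j ^ n
  have hS : 0 < S := hbr.tsum_pos (fun j => (mul_pos (hb j) (pow_pos (hr j) n)).le) 0
    (mul_pos (hb 0) (pow_pos (hr 0) n))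
  have hzero : truncatedPowerSum n r b 0 = S := by
    simp only [truncatedPowerSum, sub_zero, S, max_eq_left (hr _).le]
  obtain ⟨M, hM, hM0⟩ := (((tendsto_truncatedPowerSum hn hr hb hbr).eventually_lt_const
    (half_pos hS)).and (eventually_ge_atTop 0)).exists
  -- At this `z` the sum has fallen to half its initial value `S`. Dividing the radii by `z` moves
  -- that point to 1, and the weights `b j * z ^ n / S` compensate and normalize the total mass.
  obtain ⟨z, hz, hzS⟩ : S / 2 ∈ (fun z => truncatedPowerSum n r b (max z 0)) '' Icc 0 M := by
    refine intermediate_value_Icc' hM0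
      (continuous_truncatedPowerSum_max hr hb hbr).continuousOn ⟨?_, ?_⟩
    · simpa [hM0] using hM.le
    · simp only [max_self, hzero]; linarith
  simp only [max_eq_left hz.1] at hzS
  have hz0 : 0 < z := by
    refine hz.1.lt_of_ne fun h => ?_
    rw [← h, hzero] at hzS
    linarith
  refine ⟨⟨fun j => r j / z, fun j => b j * z ^ n / S, fun j => div_pos (hr j) hz0,
    fun j => div_pos (mul_pos (hb j) (pow_pos hz0 n)) hS, ?_, (hbs.mul_right _).div_const _,
    ?_, ?_⟩⟩
  · intro x y hx hxy
    obtain ⟨j, h1, h2⟩ := hdense (x * z) (y * z) (by positivity) (by gcongr)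
    exact ⟨j, (lt_div_iff₀ hz0).2 h1, (div_lt_iff₀ hz0).2 h2⟩
  · have h : HasSum _ (S / S) := hbr.hasSum.div_const S
    rw [div_self hS.ne'] at h
    convert h using 2 with j
    rw [div_pow]
    field_simp
  · have h : HasSum _ (truncatedPowerSum n r b z / S) :=
      (summable_truncatedPower hr hb hbr hz.1).hasSum.div_const S
    rw [hzS, div_right_comm, div_self hS.ne'] at h
    convert h using 2 with j
    have : max (r j / z - 1) 0 = max (r j - z) 0 / z := by
      rw [← max_div_div_right hz0.le, sub_div, div_self hz0.ne', zero_div]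
    rw [this, div_pow]
    field_simp

/-! ### The generator and its inverse -/

namespace DenseAtoms

variable {n : ℕ} (D : DenseAtoms n)

/-- The generator `ψ`, extended to `ℝ` by `1` on the negative axis. -/
noncomputable def gen (z : ℝ) : I :=
  projIcc 0 1 zero_le_one (truncatedPowerSum n D.r D.c (max z 0))

theorem gen_of_nonpos {z : ℝ} (hz : z ≤ 0) : D.gen z = 1 := by
  have h : truncatedPowerSum n D.r D.c 0 = 1 := by
    simp only [truncatedPowerSum, sub_zero, max_eq_left (D.r_pos _).le, D.hasSum_one.tsum_eq]
  rw [gen, max_eq_right hz, h]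
  exact projIcc_right _

theorem continuous_gen : Continuous D.gen :=
  continuous_projIcc.comp
    (continuous_truncatedPowerSum_max D.r_pos D.c_pos D.hasSum_one.summable)

theorem exists_lt_r (z : ℝ) : ∃ j, z < D.r j := by
  obtain ⟨j, hj, -⟩ := D.dense (max z 0) (max z 0 + 1) (le_max_right _ _) (lt_add_one _)
  exact ⟨j, (le_max_left _ _).trans_lt hj⟩

theorem hasSum_gen {z : ℝ} (hz : 0 ≤ z) :
    HasSum (fun j => D.c j * (max (D.r j - z) 0) ^ n) (D.gen z : ℝ) := by
  have hs := summable_truncatedPower D.r_pos D.c_pos D.hasSum_one.summable hz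
  have h0 : ∀ j, 0 ≤ D.c j * (max (D.r j - z) 0) ^ n :=
    fun j => mul_nonneg (D.c_pos j).le (by positivity)
  have h1 : truncatedPowerSum n D.r D.c z ≤ 1 := by
    rw [truncatedPowerSum, ← D.hasSum_one.tsum_eq]
    exact hs.tsum_le_tsum (fun j => mul_le_mul_of_nonneg_left
      (truncatedPower_le D.r_pos hz j) (D.c_pos j).le) D.hasSum_one.summable
  rw [gen, max_eq_left hz, projIcc_of_mem (x := truncatedPowerSum n D.r D.c z) _
    ⟨tsum_nonneg h0, h1⟩]
  exact hs.hasSum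

theorem coe_gen {z : ℝ} (hz : 0 ≤ z) : (D.gen z : ℝ) = truncatedPowerSum n D.r D.c z :=
  (D.hasSum_gen hz).tsum_eq.symm

theorem gen_one : (D.gen 1 : ℝ) = 1 / 2 :=
  (D.hasSum_gen zero_le_one).unique D.hasSum_half

/-- The generator as a function on `[0, ∞)`. -/
noncomputable def generator (z : ℝ≥0) : I := D.gen z

theorem extendGenerator_top : extendGenerator D.generator ⊤ = 0 := by
  simp [extendGenerator]

/-- The inverse of the generator, with real values. -/
noncomputable def genInv (u : I) : ℝ := (pseudoInverse D.generator u).toReal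

theorem genInv_nonneg (u : I) : 0 ≤ D.genInv u := ENNReal.toReal_nonneg

theorem extendGenerator_ofReal {z : ℝ} (hz : 0 ≤ z) :
    extendGenerator D.generator (ENNReal.ofReal z) = D.gen z := by
  rw [extendGenerator, if_neg ENNReal.ofReal_ne_top, generator]
  exact congrArg D.gen (Real.coe_toNNReal z hz)

variable [NeZero n]

theorem strictAntiOn_gen : StrictAntiOn D.gen (Ici 0) := by
  intro z hz w hw hzw
  rw [← Subtype.coe_lt_coe, D.coe_gen hz, D.coe_gen hw]
  exact truncatedPowerSum_strictAntiOn (NeZero.ne n) D.r_pos D.c_pos D.hasSum_one.summable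
    D.exists_lt_r hz hw hzw

theorem gen_le_gen_iff {z w : ℝ} (hz : 0 ≤ z) (hw : 0 ≤ w) : D.gen z ≤ D.gen w ↔ w ≤ z :=
  D.strictAntiOn_gen.le_iff_ge hz hw

theorem gen_lt_gen_iff {z w : ℝ} (hz : 0 ≤ z) (hw : 0 ≤ w) : D.gen z < D.gen w ↔ w < z :=
  D.strictAntiOn_gen.lt_iff_gt hz hw

theorem gen_inj {z w : ℝ} (hz : 0 ≤ z) (hw : 0 ≤ w) : D.gen z = D.gen w ↔ z = w :=
  D.strictAntiOn_gen.injOn.eq_iff hz hw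

theorem gen_pos (z : ℝ) : 0 < D.gen z := by
  rcases le_total z 0 with hz | hz
  · rw [D.gen_of_nonpos hz]; exact zero_lt_one
  · exact (show (0 : I) ≤ D.gen (z + 1) from unitInterval.nonneg').trans_lt
      ((D.gen_lt_gen_iff (by linarith) hz).2 (lt_add_one z))

theorem gen_lt_one_iff {z : ℝ} : D.gen z < 1 ↔ 0 < z := by
  rcases le_or_gt z 0 with hz | hz
  · simp [D.gen_of_nonpos hz, hz]
  · rw [← D.gen_of_nonpos le_rfl, D.gen_lt_gen_iff hz.le le_rfl]

theorem tendsto_gen : Tendsto D.gen atTop (𝓝 0) := by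
  rw [tendsto_subtype_rng]
  refine (tendsto_truncatedPowerSum (NeZero.ne n) D.r_pos D.c_pos D.hasSum_one.summable).congr' ?_
  filter_upwards [eventually_ge_atTop 0] with z hz
  exact (D.coe_gen hz).symm

theorem exists_gen_eq {u : I} (hu : u ≠ 0) : ∃ z, 0 ≤ z ∧ D.gen z = u := by
  have hu' : 0 < u := unitInterval.pos_iff_ne_zero.2 hu
  obtain ⟨M, hM, hM0⟩ :=
    ((D.tendsto_gen.eventually_lt_const hu').and (eventually_ge_atTop 0)).exists
  obtain ⟨z, hz, hzu⟩ := intermediate_value_Icc' hM0 D.continuous_gen.continuousOn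
    (show u ∈ Icc (D.gen M) (D.gen 0) from
      ⟨hM.le, by rw [D.gen_of_nonpos le_rfl]; exact unitInterval.le_one'⟩)
  exact ⟨z, hz.1, hzu⟩

/-- The density statement behind both step functions: `s = 0` serves the Kendall function, `s =
level u` the conditional laws. -/
theorem exists_atom_between {s : ℝ} (hs : 0 ≤ s) {u v : I} (huv : u < v) :
    ∃ j, s < D.r j ∧ u < D.gen (D.r j - s) ∧ D.gen (D.r j - s) < v := by
  -- `u` may be 0, which ψ does not attain at any finite point; the intermediate values are positive
  -- and so have real preimages.
  obtain ⟨y, huy, hyv⟩ := exists_between huv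
  obtain ⟨x, hux, hxy⟩ := exists_between huy
  obtain ⟨z, hz, rfl⟩ := D.exists_gen_eq (unitInterval.nonneg'.trans_lt hux).ne'
  obtain ⟨w, hw, rfl⟩ := D.exists_gen_eq (unitInterval.nonneg'.trans_lt huy).ne'
  rw [D.gen_lt_gen_iff hz hw] at hxy
  obtain ⟨j, h1, h2⟩ := D.dense (s + w) (s + z) (by linarith) (by linarith)
  refine ⟨j, by linarith, hux.trans ?_, lt_trans ?_ hyv⟩
  · exact (D.gen_lt_gen_iff hz (by linarith)).2 (by linarith)
  · exact (D.gen_lt_gen_iff (by linarith) hw).2 (by linarith)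

theorem strictAnti_extendGenerator : StrictAnti (extendGenerator D.generator) := by
  intro a b hab
  have ha : a ≠ ⊤ := hab.ne_top
  rw [← ENNReal.ofReal_toReal ha, D.extendGenerator_ofReal ENNReal.toReal_nonneg]
  rcases eq_or_ne b ⊤ with rfl | hb
  · rw [D.extendGenerator_top]
    exact D.gen_pos _
  · rw [← ENNReal.ofReal_toReal hb, D.extendGenerator_ofReal ENNReal.toReal_nonneg,
      D.gen_lt_gen_iff ENNReal.toReal_nonneg ENNReal.toReal_nonneg]
    exact ENNReal.toReal_strict_mono hb hab

theorem pseudoInverse_extendGenerator (z : ℝ≥0∞) :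
    pseudoInverse D.generator (extendGenerator D.generator z) = z := by
  have : {w | extendGenerator D.generator w = extendGenerator D.generator z} = {z} := by
    ext w
    exact D.strictAnti_extendGenerator.injective.eq_iff
  rw [pseudoInverse, this, sInf_singleton]

theorem pseudoInverse_gen {z : ℝ} (hz : 0 ≤ z) :
    pseudoInverse D.generator (D.gen z) = ENNReal.ofReal z := by
  rw [← D.extendGenerator_ofReal hz, D.pseudoInverse_extendGenerator]

theorem pseudoInverse_zero : pseudoInverse D.generator 0 = ⊤ := by
  rw [← D.extendGenerator_top, D.pseudoInverse_extendGenerator]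

theorem extendGenerator_pseudoInverse (u : I) :
    extendGenerator D.generator (pseudoInverse D.generator u) = u := by
  rcases eq_or_ne u 0 with rfl | hu
  · rw [D.pseudoInverse_zero, D.extendGenerator_top]
  · obtain ⟨z, hz, rfl⟩ := D.exists_gen_eq hu
    rw [D.pseudoInverse_gen hz, D.extendGenerator_ofReal hz]

theorem measurable_pseudoInverse : Measurable (pseudoInverse D.generator) := by
  refine Antitone.measurable fun u v huv => ?_
  rw [← D.strictAnti_extendGenerator.le_iff_ge]
  simpa only [D.extendGenerator_pseudoInverse]

theorem isArchimedeanGenerator : IsArchimedeanGenerator D.generator where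
  continuous := D.continuous_gen.comp NNReal.continuous_coe
  antitone := fun _ _ h => (D.gen_le_gen_iff NNReal.zero_le_coe NNReal.zero_le_coe).2 h
  map_zero := D.gen_of_nonpos le_rfl
  tendsto_zero := D.tendsto_gen.comp (NNReal.tendsto_coe_atTop.2 tendsto_id)
  strictAntiOn := D.strictAnti_extendGenerator.strictAntiOn _
  normalized := D.gen_one

theorem genInv_gen {z : ℝ} (hz : 0 ≤ z) : D.genInv (D.gen z) = z := by
  rw [genInv, D.pseudoInverse_gen hz, ENNReal.toReal_ofReal hz]

theorem gen_genInv {u : I} (hu : u ≠ 0) : D.gen (D.genInv u) = u := by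
  obtain ⟨z, hz, rfl⟩ := D.exists_gen_eq hu
  rw [D.genInv_gen hz]

theorem measurable_genInv : Measurable D.genInv := D.measurable_pseudoInverse.ennreal_toReal

/-! ### The copula in terms of the generator -/

variable {d : ℕ}

/-- The Archimedean copula with generator `ψ`. -/
noncomputable def copula (x : Fin d → I) : I := archimedeanFunction D.generator x

theorem measurable_copula : Measurable (D.copula (d := d)) :=
  D.strictAnti_extendGenerator.antitone.measurable.comp
    (Finset.measurable_fun_sum _ fun i _ => D.measurable_pseudoInverse.comp (measurable_pi_apply i))

theorem copula_gen {z : Fin d → ℝ} (hz : ∀ i, 0 ≤ z i) :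
    D.copula (fun i => D.gen (z i)) = D.gen (∑ i, z i) := by
  rw [copula, archimedeanFunction]
  simp only [D.pseudoInverse_gen (hz _)]
  rw [← ENNReal.ofReal_sum_of_nonneg fun i _ => hz i,
    D.extendGenerator_ofReal (Finset.sum_nonneg fun i _ => hz i)]

theorem copula_of_ne_zero {x : Fin d → I} (hx : ∀ i, x i ≠ 0) :
    D.copula x = D.gen (∑ i, D.genInv (x i)) := by
  rw [← D.copula_gen fun i => D.genInv_nonneg (x i)]
  simp only [D.gen_genInv (hx _)]

theorem copula_of_eq_zero {x : Fin d → I} {i : Fin d} (hx : x i = 0) : D.copula x = 0 := by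
  have : ∑ i, pseudoInverse D.generator (x i) = ⊤ :=
    ENNReal.sum_eq_top.2 ⟨i, Finset.mem_univ i, by rw [hx, D.pseudoInverse_zero]⟩
  rw [copula, archimedeanFunction, this, D.extendGenerator_top]

end DenseAtoms

/-! ### Distribution functions of discrete measures -/

section discrete

variable {ν : Measure I} [IsFiniteMeasure ν] {a : ℕ → I} {w : ℕ → ℝ≥0∞}

theorem isStepFunction_of_discrete (hν : ν = Measure.sum fun j => w j • Measure.dirac (a j)) :
    IsStepFunction fun y => ν.real (Iic y) := by
  refine ⟨a, fun j => (w j).toReal, fun j => ENNReal.toReal_nonneg, fun y => ?_⟩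
  have happ : ν (Iic y) = ∑' j, (Ici (a j)).indicator (fun _ => w j) y := by
    rw [hν, Measure.sum_apply _ measurableSet_Iic]
    refine tsum_congr fun j => ?_
    by_cases h : a j ≤ y <;> simp [h]
  have hfin : ∑' j, (Ici (a j)).indicator (fun _ => w j) y ≠ ⊤ := by
    rw [← happ]; exact measure_ne_top _ _
  have h := ENNReal.hasSum_toReal hfin
  rw [← ENNReal.tsum_toReal_eq (ENNReal.ne_top_of_tsum_ne_top hfin), ← happ] at h
  change HasSum _ (ν (Iic y)).toReal
  convert h using 2 with j
  by_cases hj : a j ≤ y <;> simp [hj]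

theorem strictMono_of_discrete (hν : ν = Measure.sum fun j => w j • Measure.dirac (a j))
    (hdense : ∀ u v, u < v → ∃ j, w j ≠ 0 ∧ u < a j ∧ a j ≤ v) :
    StrictMono fun y => ν.real (Iic y) := by
  intro u v huv
  obtain ⟨j, hj, h1, h2⟩ := hdense u v huv
  have hpos : 0 < ν.real (Ioc u v) := by
    refine ENNReal.toReal_pos ?_ (measure_ne_top _ _)
    have : w j ≤ ν (Ioc u v) := by
      rw [hν, Measure.sum_apply _ measurableSet_Ioc]
      refine le_trans ?_ (ENNReal.le_tsum j)
      simp [h1, h2]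
    exact ((pos_iff_ne_zero.2 hj).trans_le this).ne'
  have : ν.real (Iic v) = ν.real (Iic u) + ν.real (Ioc u v) := by
    rw [← Iic_union_Ioc_eq_Iic huv.le]
    exact measureReal_union (Iic_disjoint_Ioc le_rfl) measurableSet_Ioc
  simp only [this]
  linarith

end discrete

/-! ### The measure on the cube and its distribution function -/

namespace DenseAtoms

variable {n : ℕ} (D : DenseAtoms n)

/-- The point of the cube whose coordinates are the images under `ψ` of the barycentric
coordinates `(x, r - ∑ x)`. -/
noncomputable def point (r : ℝ) (x : Fin n → ℝ) : Fin (n + 1) → I :=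
  Fin.snoc (α := fun _ => I) (fun i => D.gen (x i)) (D.gen (r - ∑ i, x i))

theorem point_eq (r : ℝ) (x : Fin n → ℝ) :
    D.point r x = fun i => D.gen (Fin.snoc (α := fun _ => ℝ) x (r - ∑ i, x i) i) := by
  ext i
  refine Fin.lastCases ?_ (fun i => ?_) i <;> simp [point]

theorem continuous_point : Continuous fun p : ℝ × (Fin n → ℝ) => D.point p.1 p.2 := by
  refine Continuous.finSnoc (A := fun _ => I) ?_ ?_
  · exact continuous_pi fun i => D.continuous_gen.comp (by fun_prop)
  · exact D.continuous_gen.comp (by fun_prop)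

theorem measurable_point (r : ℝ) : Measurable (D.point r) :=
  (D.continuous_point.comp (by fun_prop : Continuous fun x : Fin n → ℝ => (r, x))).measurable

/-- The part of the law of the first `n` coordinates that belongs to the `j`-th atom. -/
noncomputable def mass (j : ℕ) : Measure (Fin n → ℝ) :=
  ENNReal.ofReal (D.c j) • (simplexMeasure n).restrict (cornerSimplex n (D.r j))

theorem mass_apply (j : ℕ) {s : Set (Fin n → ℝ)} (hs : MeasurableSet s) :
    D.mass j s = ENNReal.ofReal (D.c j) * simplexMeasure n (s ∩ cornerSimplex n (D.r j)) := by
  rw [mass, Measure.smul_apply, Measure.restrict_apply hs, smul_eq_mul]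

theorem ae_mass (j : ℕ) : ∀ᵐ x ∂(D.mass j), x ∈ cornerSimplex n (D.r j) :=
  Measure.ae_smul_measure (ae_restrict_mem (measurableSet_cornerSimplex _ _)) _

/-- The measure of the copula. -/
noncomputable def law : Measure (Fin (n + 1) → I) :=
  Measure.sum fun j => (D.mass j).map (D.point (D.r j))

theorem law_apply {s : Set (Fin (n + 1) → I)} (hs : MeasurableSet s) :
    D.law s = ∑' j, D.mass j (D.point (D.r j) ⁻¹' s) := by
  rw [law, Measure.sum_apply _ hs]
  exact tsum_congr fun j => Measure.map_apply (D.measurable_point _) hs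

theorem cornerSimplex_snoc_nonneg {r : ℝ} {x : Fin n → ℝ} (hx : x ∈ cornerSimplex n r)
    (i : Fin (n + 1)) : 0 ≤ (Fin.snoc (α := fun _ => ℝ) x (r - ∑ i, x i) i : ℝ) := by
  refine Fin.lastCases ?_ (fun i => ?_) i
  · simpa using hx.2
  · simpa using hx.1 i

theorem weight_ne_zero (j : ℕ) : ENNReal.ofReal (D.c j * D.r j ^ n) ≠ 0 :=
  (ENNReal.ofReal_pos.2 (mul_pos (D.c_pos j) (pow_pos (D.r_pos j) n))).ne'

variable [NeZero n]

theorem copula_point {r : ℝ} {x : Fin n → ℝ} (hx : x ∈ cornerSimplex n r) :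
    D.copula (D.point r x) = D.gen r := by
  rw [point_eq, D.copula_gen (cornerSimplex_snoc_nonneg hx), Fin.sum_univ_castSucc]
  simp

theorem law_Iic (u : Fin (n + 1) → I) :
    D.law (Iic u) = ENNReal.ofReal (D.copula u : ℝ) := by
  rw [D.law_apply measurableSet_Iic]
  by_cases hu : ∃ i, u i = 0
  -- ψ is positive everywhere, so no point of any piece has a vanishing coordinate.
  · obtain ⟨i, hi⟩ := hu
    rw [D.copula_of_eq_zero hi, ENNReal.tsum_eq_zero.2]
    · simp
    intro j
    convert measure_empty (μ := D.mass j)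
    refine eq_empty_of_forall_notMem fun x hx => ?_
    have h := hx i
    rw [hi, point_eq] at h
    exact h.not_gt (D.gen_pos _)
  · push Not at hu
    set z : Fin (n + 1) → ℝ := fun i => D.genInv (u i) with hz
    have hz0 : ∀ i, 0 ≤ z i := fun i => D.genInv_nonneg _
    have hterm : ∀ j, D.mass j (D.point (D.r j) ⁻¹' Iic u) =
        ENNReal.ofReal (D.c j * (max (D.r j - ∑ i, z i) 0) ^ n) := by
      intro j
      have hset : D.point (D.r j) ⁻¹' Iic u ∩ cornerSimplex n (D.r j) =
          {x | (∀ i : Fin n, z i.castSucc ≤ x i) ∧ ∑ i, x i ≤ D.r j - z (Fin.last n)} := by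
        ext x
        constructor
        · rintro ⟨hx, hxs⟩
          have h : ∀ i, z i ≤ (Fin.snoc (α := fun _ => ℝ) x (D.r j - ∑ i, x i) i : ℝ) := by
            intro i
            have := hx i
            rwa [point_eq, ← D.gen_genInv (hu i),
              D.gen_le_gen_iff (cornerSimplex_snoc_nonneg hxs i) (hz0 i)] at this
          refine ⟨fun i => by simpa using h i.castSucc, ?_⟩
          have := h (Fin.last n)
          simp only [Fin.snoc_last] at this
          linarith
        · rintro ⟨hx, hxs⟩
          have hmem : x ∈ cornerSimplex n (D.r j) :=
            ⟨fun i => (hz0 _).trans (hx i), by linarith [hz0 (Fin.last n)]⟩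
          refine ⟨fun i => ?_, hmem⟩
          rw [point_eq, ← D.gen_genInv (hu i),
            D.gen_le_gen_iff (cornerSimplex_snoc_nonneg hmem i) (hz0 i)]
          refine Fin.lastCases ?_ (fun i => ?_) i
          · simp only [Fin.snoc_last]
            linarith
          · simpa using hx i
      rw [D.mass_apply j (D.measurable_point _ measurableSet_Iic), hset,
        simplexMeasure_shifted (NeZero.ne n), ← ENNReal.ofReal_mul (D.c_pos j).le,
        Fin.sum_univ_castSucc, sub_sub, add_comm (z (Fin.last n))]
    have hs := D.hasSum_gen (Finset.sum_nonneg fun i (_ : i ∈ Finset.univ) => hz0 i)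
    simp only [hterm]
    rw [← ENNReal.ofReal_tsum_of_nonneg
      (fun j => mul_nonneg (D.c_pos j).le (by positivity)) hs.summable, hs.tsum_eq,
      D.copula_of_ne_zero hu]

theorem isProbabilityMeasure_law : IsProbabilityMeasure D.law := by
  refine ⟨?_⟩
  have h : D.copula (fun _ : Fin (n + 1) => (1 : I)) = 1 := by
    have := D.copula_gen (fun _ : Fin (n + 1) => le_refl (0 : ℝ))
    simpa [D.gen_of_nonpos le_rfl] using this
  have hu : (univ : Set (Fin (n + 1) → I)) = Iic fun _ => 1 :=
    (eq_univ_of_forall fun x i => unitInterval.le_one').symm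
  rw [hu, D.law_Iic, h]
  simp

theorem map_law_eval (i : Fin (n + 1)) : D.law.map (fun x => x i) = (volume : Measure I) := by
  have := D.isProbabilityMeasure_law
  refine Measure.ext_of_Iic _ _ fun t => ?_
  rw [Measure.map_apply (measurable_pi_apply i) measurableSet_Iic, unitInterval.volume_Iic]
  -- A marginal event is a lower orthant whose other bounds are 1 = ψ(0), where the copula reduces
  -- to ψ(z) = t.
  have hset : (fun x : Fin (n + 1) → I => x i) ⁻¹' Iic t =
      Iic (Function.update (fun _ => 1) i t) := by
    ext x
    simp [Pi.le_def, Function.update_apply]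
    refine ⟨fun h k => ?_, fun h => by simpa using h i⟩
    split_ifs with hk
    · exact hk ▸ h
    · exact unitInterval.le_one'
  rw [hset, D.law_Iic]
  congr 2
  rcases eq_or_ne t 0 with rfl | ht
  · exact D.copula_of_eq_zero (i := i) (by simp)
  · obtain ⟨z, hz, rfl⟩ := D.exists_gen_eq ht
    have h := D.copula_gen (z := Function.update (fun _ : Fin (n + 1) => (0 : ℝ)) i z) fun k => by
      rw [Function.update_apply]; split_ifs <;> simp [hz]
    rw [Finset.sum_update_of_mem (Finset.mem_univ i)] at h
    simp only [Finset.sum_const_zero, add_zero] at h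
    refine (congrArg D.copula ?_).trans h
    ext1 k
    rw [Function.update_apply, Function.update_apply]
    split_ifs
    · rfl
    · rw [D.gen_of_nonpos (le_refl (0 : ℝ))]

theorem isArchimedeanCopula_law :
    IsArchimedeanCopulaWithMeasure (D.copula (d := n + 1)) D.law :=
  ⟨⟨⟨D.isProbabilityMeasure_law, D.map_law_eval⟩, D.law_Iic⟩,
    D.generator, D.isArchimedeanGenerator, rfl⟩

theorem law_singleton (x : Fin (n + 1) → I) : D.law {x} = 0 := by
  refine measure_mono_null (t := (fun y : Fin (n + 1) → I => y 0) ⁻¹' {x 0}) ?_ ?_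
  · rintro _ rfl
    rfl
  · rw [← Measure.map_apply (measurable_pi_apply 0) (measurableSet_singleton _), D.map_law_eval]
    exact measure_singleton _

/-! ### The Kendall function and the level sets -/

theorem map_copula_law : D.law.map D.copula =
    Measure.sum fun j => ENNReal.ofReal (D.c j * D.r j ^ n) • Measure.dirac (D.gen (D.r j)) := by
  rw [law, Measure.map_sum D.measurable_copula.aemeasurable]
  congr 1
  ext1 j
  rw [Measure.map_map D.measurable_copula (D.measurable_point _),
    Measure.map_congr (g := fun _ => D.gen (D.r j)), Measure.map_const,
    D.mass_apply j MeasurableSet.univ, univ_inter,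
    simplexMeasure_cornerSimplex (NeZero.ne n) (D.r_pos j).le, ← ENNReal.ofReal_mul (D.c_pos j).le]
  filter_upwards [D.ae_mass j] with x hx
  exact D.copula_point hx

theorem kendallFunction_eq :
    kendallFunction D.copula D.law = fun t => (D.law.map D.copula).real (Iic t) := by
  ext t
  rw [map_measureReal_apply D.measurable_copula measurableSet_Iic]
  rfl

theorem strictMono_kendallFunction : StrictMono (kendallFunction D.copula D.law) := by
  have := D.isProbabilityMeasure_law
  rw [D.kendallFunction_eq]
  refine strictMono_of_discrete D.map_copula_law fun u v huv => ?_
  obtain ⟨j, -, h1, h2⟩ := D.exists_atom_between le_rfl huv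
  rw [sub_zero] at h1 h2
  exact ⟨j, D.weight_ne_zero j, h1, h2.le⟩

theorem isStepFunction_kendallFunction : IsStepFunction (kendallFunction D.copula D.law) := by
  have := D.isProbabilityMeasure_law
  rw [D.kendallFunction_eq]
  exact isStepFunction_of_discrete D.map_copula_law

theorem law_levelSet_pos_iff (t : I) :
    0 < D.law (levelSet D.copula t) ↔ t ∈ range fun j => D.gen (D.r j) := by
  have h : D.law (levelSet D.copula t) = D.law.map D.copula {t} := by
    rw [Measure.map_apply D.measurable_copula (measurableSet_singleton t)]
    rfl
  rw [h, D.map_copula_law, Measure.sum_apply _ (measurableSet_singleton t), pos_iff_ne_zero, Ne,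
    ENNReal.tsum_eq_zero, not_forall, mem_range]
  refine exists_congr fun j => ?_
  by_cases hj : D.gen (D.r j) = t
  · simp [hj, pow_pos (D.r_pos j), D.c_pos j]
  · simp [hj]

theorem gen_r_mem_Ioo (j : ℕ) : D.gen (D.r j) ∈ Ioo 0 1 :=
  ⟨D.gen_pos _, D.gen_lt_one_iff.2 (D.r_pos j)⟩

theorem Ioo_subset_closure_range : Ioo 0 1 ⊆ closure (range fun j => D.gen (D.r j)) := by
  have hd : Dense (range fun j => D.gen (D.r j)) := by
    refine dense_of_exists_between fun u v huv => ?_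
    obtain ⟨j, -, h1, h2⟩ := D.exists_atom_between le_rfl huv
    rw [sub_zero] at h1 h2
    exact ⟨_, mem_range_self j, h1, h2⟩
  rw [hd.closure_eq]
  exact subset_univ _

/-! ### Singularity and full support -/

/-- Fubini: once the other coordinates are fixed, injectivity of ψ leaves at most one value for the
first. For `t = 0` a section can be a whole interval. -/
theorem volume_levelSet {t : I} (ht : t ≠ 0) :
    volume (levelSet (D.copula (d := n + 1)) t) = 0 := by
  have hm : MeasurableSet (levelSet (D.copula (d := n + 1)) t) :=
    D.measurable_copula (measurableSet_singleton t)
  have he := (volume_preserving_piFinSuccAbove (fun _ : Fin (n + 1) => I) 0).symm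
  rw [← he.measure_preimage hm.nullMeasurableSet, Measure.volume_eq_prod,
    Measure.prod_apply_symm (he.measurable hm)]
  refine (lintegral_congr fun y => ?_).trans lintegral_zero
  refine Set.Subsingleton.measure_zero ?_ _
  have hcons : ∀ x : I, (MeasurableEquiv.piFinSuccAbove (fun _ : Fin (n + 1) => I) 0).symm (x, y) =
      Fin.cons x y := by
    intro x
    simp
    rfl
  have key : ∀ x : I, D.copula (Fin.cons (α := fun _ => I) x y) = t →
      x ≠ 0 ∧ D.gen (D.genInv x + ∑ i, D.genInv (y i)) = t := by
    intro x hx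
    have hne : ∀ i, (Fin.cons (α := fun _ => I) x y : Fin (n + 1) → I) i ≠ 0 :=
      fun i hi => ht (hx ▸ D.copula_of_eq_zero hi)
    refine ⟨by simpa using hne 0, ?_⟩
    rw [D.copula_of_ne_zero hne, Fin.sum_univ_succ] at hx
    simpa using hx
  have hs : 0 ≤ ∑ i, D.genInv (y i) := Finset.sum_nonneg fun i _ => D.genInv_nonneg _
  intro x hx x' hx'
  obtain ⟨h0, h⟩ := key x ((congrArg D.copula (hcons x)).symm.trans hx)
  obtain ⟨h0', h'⟩ := key x' ((congrArg D.copula (hcons x')).symm.trans hx')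
  rw [← h', D.gen_inj (add_nonneg (D.genInv_nonneg _) hs) (add_nonneg (D.genInv_nonneg _) hs),
    add_left_inj] at h
  rw [← D.gen_genInv h0, h, D.gen_genInv h0']

theorem mutuallySingular_law : D.law ⟂ₘ (volume : Measure (Fin (n + 1) → I)) := by
  have hm : MeasurableSet (range fun j => D.gen (D.r j)) := (countable_range _).measurableSet
  refine ⟨D.copula ⁻¹' (range fun j => D.gen (D.r j))ᶜ, D.measurable_copula hm.compl, ?_, ?_⟩
  · rw [← Measure.map_apply D.measurable_copula hm.compl, D.map_copula_law,
      Measure.sum_apply _ hm.compl, ENNReal.tsum_eq_zero]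
    intro j
    simp
  · rw [← preimage_compl, compl_compl, ← biUnion_preimage_singleton,
      measure_biUnion_null_iff (countable_range _)]
    rintro _ ⟨j, rfl⟩
    exact D.volume_levelSet (D.gen_pos _).ne'

theorem isOpenPosMeasure_law : D.law.IsOpenPosMeasure := by
  refine ⟨fun U hU hne => ?_⟩
  have hd : Dense (univ.pi fun _ : Fin (n + 1) => Ioo (0 : I) 1) :=
    dense_pi univ fun i _ => by
      rw [dense_iff_closure_eq, closure_Ioo zero_ne_one]
      exact eq_univ_of_forall fun x => ⟨unitInterval.nonneg', unitInterval.le_one'⟩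
  obtain ⟨u, huU, hu⟩ := hd.inter_open_nonempty U hU hne
  have hopen : IsOpen (U ∩ univ.pi fun _ : Fin (n + 1) => Ioo (0 : I) 1) :=
    hU.inter (isOpen_set_pi finite_univ fun _ _ => isOpen_Ioo)
  have hpre := hopen.preimage D.continuous_point
  set z : Fin n → ℝ := fun i => D.genInv (u i.castSucc) with hz
  set s : ℝ := ∑ i, z i + D.genInv (u (Fin.last n)) with hs
  have hmem : D.point s z = u := by
    ext1 i
    refine Fin.lastCases ?_ (fun i => ?_) i
    · simp [point, hs, D.gen_genInv (hu (Fin.last n) trivial).1.ne']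
    · simp [point, hz, D.gen_genInv (hu i.castSucc trivial).1.ne']
  obtain ⟨A, B, hA, hB, hsA, hzB, hAB⟩ := isOpen_prod_iff.1 hpre s z
    (by rw [mem_preimage, hmem]; exact ⟨huU, hu⟩)
  have hs0 : 0 ≤ s :=
    add_nonneg (Finset.sum_nonneg fun i _ => D.genInv_nonneg _) (D.genInv_nonneg _)
  obtain ⟨ε, hε, hεA⟩ := Metric.isOpen_iff.1 hA s hsA
  obtain ⟨j, h1, h2⟩ := D.dense s (s + ε) hs0 (by linarith)
  have hjA : D.r j ∈ A := hεA (by rw [Metric.mem_ball, Real.dist_eq, abs_lt]; constructor <;> linarith)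
  -- Coordinates below 1 force positive barycentric coordinates, because `gen` equals 1 on the
  -- nonpositive axis; so all of `B` lies in the simplex.
  have hsub : B ⊆ D.point (D.r j) ⁻¹' U ∩ cornerSimplex n (D.r j) := by
    intro x hx
    obtain ⟨hxU, hxI⟩ := hAB (mk_mem_prod hjA hx)
    refine ⟨hxU, fun i => ?_, ?_⟩
    · have := (hxI i.castSucc trivial).2
      simp only [point, Fin.snoc_castSucc] at this
      exact (D.gen_lt_one_iff.1 this).le
    · have := (hxI (Fin.last n) trivial).2
      simp only [point, Fin.snoc_last] at this
      linarith [D.gen_lt_one_iff.1 this]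
  rw [D.law_apply hU.measurableSet]
  refine ((lt_of_lt_of_le ?_ (ENNReal.le_tsum j))).ne'
  rw [D.mass_apply j (D.measurable_point _ hU.measurableSet)]
  exact ENNReal.mul_pos (ENNReal.ofReal_pos.2 (D.c_pos j)).ne'
    ((hB.simplexMeasure_pos ⟨z, hzB⟩).trans_le (measure_mono hsub)).ne'

end DenseAtoms

/-! ### Disintegration along the last coordinate -/

theorem measurable_finInit {n : ℕ} : Measurable fun x : Fin (n + 1) → I => (Fin.init x : Fin n → I) :=
  measurable_pi_lambda _ fun i => measurable_pi_apply i.castSucc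

namespace DenseAtoms

variable {n : ℕ} (D : DenseAtoms n)

/-- The weight `cⱼ`, as long as the atom `rⱼ` is not below `s`. -/
noncomputable def tailWeight (j : ℕ) (s : ℝ) : ℝ≥0∞ :=
  (Iic (D.r j)).indicator (fun _ => ENNReal.ofReal (D.c j)) s

theorem measurable_tailWeight (j : ℕ) : Measurable (D.tailWeight j) :=
  measurable_const.indicator measurableSet_Iic

/-- The total weight of the atoms not below `s`. -/
noncomputable def tailMass (s : ℝ) : ℝ≥0∞ := ∑' j, D.tailWeight j s

theorem measurable_tailMass : Measurable D.tailMass :=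
  Measurable.tsum D.measurable_tailWeight

/-- Summability of `c` itself makes this hold even at `s = 0`, so the kernel is Markov at every
point and not only almost everywhere. -/
theorem tailMass_ne_top (s : ℝ) : D.tailMass s ≠ ⊤ := by
  refine ((ENNReal.tsum_le_tsum fun j => ?_).trans_lt
    D.summable_c.tsum_ofReal_lt_top).ne
  exact indicator_le_self _ _ s

theorem tailMass_ne_zero (s : ℝ) : D.tailMass s ≠ 0 := by
  obtain ⟨j, hj⟩ := D.exists_lt_r s
  rw [tailMass, Ne, ENNReal.tsum_eq_zero, not_forall]
  refine ⟨j, ?_⟩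
  simp [tailWeight, hj.le, D.c_pos j]

/-- Refers all pieces to one measure on the orthant, so that the sum over atoms can be moved inside
the integral. -/
theorem lintegral_mass (j : ℕ) {f : (Fin n → ℝ) → ℝ≥0∞} (hf : Measurable f) :
    ∫⁻ x, f x ∂(D.mass j) =
      ∫⁻ x in {x | ∀ i, 0 ≤ x i}, D.tailWeight j (∑ i, x i) * f x ∂(simplexMeasure n) := by
  have hm : MeasurableSet {x : Fin n → ℝ | ∑ i, x i ≤ D.r j} :=
    measurableSet_le (by fun_prop) measurable_const
  have hset : cornerSimplex n (D.r j) = {x | ∑ i, x i ≤ D.r j} ∩ {x | ∀ i, 0 ≤ x i} := by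
    ext x
    exact and_comm
  have hind : ∀ x : Fin n → ℝ, D.tailWeight j (∑ i, x i) * f x =
      {x : Fin n → ℝ | ∑ i, x i ≤ D.r j}.indicator (fun x => ENNReal.ofReal (D.c j) * f x) x := by
    intro x
    by_cases hx : ∑ i, x i ≤ D.r j <;> simp [tailWeight, hx]
  simp only [hind]
  rw [lintegral_indicator hm, Measure.restrict_restrict hm, ← hset, lintegral_const_mul _ hf, mass,
    lintegral_smul_measure, smul_eq_mul]

/-- The sum of the `ψ`-preimages of the coordinates. -/
noncomputable def level (u : Fin n → I) : ℝ := ∑ i, D.genInv (u i)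

theorem level_nonneg (u : Fin n → I) : 0 ≤ D.level u :=
  Finset.sum_nonneg fun _ _ => D.genInv_nonneg _

/-- The conditional weight of the `j`-th atom. -/
noncomputable def condWeight (j : ℕ) (s : ℝ) : ℝ≥0∞ := (D.tailMass s)⁻¹ * D.tailWeight j s

theorem measurable_condWeight (j : ℕ) : Measurable (D.condWeight j) :=
  D.measurable_tailMass.inv.mul (D.measurable_tailWeight j)

theorem tailMass_mul_condWeight (j : ℕ) (s : ℝ) :
    D.tailMass s * D.condWeight j s = D.tailWeight j s := by
  rw [condWeight, ← mul_assoc, ENNReal.mul_inv_cancel (D.tailMass_ne_zero s) (D.tailMass_ne_top s),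
    one_mul]

theorem measurable_gen_comp : Measurable fun (x : Fin n → ℝ) (i : Fin n) => D.gen (x i) :=
  measurable_pi_lambda _ fun i => D.continuous_gen.measurable.comp (measurable_pi_apply i)

theorem firstMarginal_law :
    firstMarginal D.law = Measure.sum fun j => (D.mass j).map fun x i => D.gen (x i) := by
  rw [firstMarginal, law, Measure.map_sum measurable_finInit.aemeasurable]
  congr 1
  ext1 j
  rw [Measure.map_map measurable_finInit (D.measurable_point _)]
  congr 1
  ext x
  simp [point]

variable [NeZero n]

theorem measurable_level : Measurable D.level :=
  Finset.measurable_fun_sum _ fun i _ => D.measurable_genInv.comp (measurable_pi_apply i)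

theorem level_gen {x : Fin n → ℝ} (hx : ∀ i, 0 ≤ x i) :
    D.level (fun i => D.gen (x i)) = ∑ i, x i :=
  Finset.sum_congr rfl fun i _ => D.genInv_gen (hx i)

/-- The conditional law of the last coordinate given the first `n` ones. -/
noncomputable def lastKernel : Kernel (Fin n → I) I where
  toFun u := Measure.sum fun j =>
    D.condWeight j (D.level u) • Measure.dirac (D.gen (D.r j - D.level u))
  measurable' := by
    refine Measure.measurable_of_measurable_coe _ fun s hs => ?_
    simp only [Measure.sum_apply _ hs, Measure.smul_apply, Measure.dirac_apply' _ hs, smul_eq_mul]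
    refine Measurable.tsum fun j => ?_
    refine ((D.measurable_condWeight j).comp D.measurable_level).mul ?_
    exact (measurable_one.indicator hs).comp
      (D.continuous_gen.measurable.comp (measurable_const.sub D.measurable_level))

theorem lastKernel_apply (u : Fin n → I) : D.lastKernel u = Measure.sum fun j =>
    D.condWeight j (D.level u) • Measure.dirac (D.gen (D.r j - D.level u)) := rfl

instance : IsMarkovKernel D.lastKernel := by
  refine ⟨fun u => ⟨?_⟩⟩
  rw [lastKernel_apply, Measure.sum_apply _ MeasurableSet.univ]
  simp only [Measure.smul_apply, measure_univ, smul_eq_mul, mul_one, condWeight]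
  rw [ENNReal.tsum_mul_left]
  exact ENNReal.inv_mul_cancel (D.tailMass_ne_zero _) (D.tailMass_ne_top _)

instance : IsFiniteMeasure (firstMarginal D.law) := by
  have := D.isProbabilityMeasure_law
  unfold firstMarginal
  infer_instance

/-- Bayes' rule over the atoms: at each x in the orthant, summing the weights of the atoms whose
image lies in `S` gives the total tail weight times the kernel's mass of the section of `S`. -/
theorem isMarkovKernelOf_lastKernel : IsMarkovKernelOf D.lastKernel D.law := by
  refine ⟨inferInstance, ?_⟩
  have hsplit : Measurable fun x : Fin (n + 1) → I => ((Fin.init x : Fin n → I), x (Fin.last n)) :=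
    measurable_finInit.prodMk (measurable_pi_apply _)
  have hP : MeasurableSet {x : Fin n → ℝ | ∀ i, 0 ≤ x i} := by
    simp only [ofPred_forall]
    exact MeasurableSet.iInter fun i => measurableSet_le measurable_const (measurable_pi_apply i)
  have hsum : Measurable fun x : Fin n → ℝ => ∑ i, x i := by fun_prop
  ext S hS
  have hpt : ∀ j, Measurable fun x : Fin n → ℝ =>
      ((fun i => D.gen (x i), D.gen (D.r j - ∑ i, x i)) : (Fin n → I) × I) := fun j =>
    D.measurable_gen_comp.prodMk
      (D.continuous_gen.measurable.comp (measurable_const.sub hsum))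
  have hind : ∀ j, Measurable fun x : Fin n → ℝ =>
      S.indicator (1 : (Fin n → I) × I → ℝ≥0∞) (fun i => D.gen (x i), D.gen (D.r j - ∑ i, x i)) :=
    fun j => (measurable_one.indicator hS).comp (hpt j)
  have hK : Measurable fun u => D.lastKernel u (Prod.mk u ⁻¹' S) :=
    Kernel.measurable_kernel_prodMk_left hS
  calc D.law.map (fun x => ((Fin.init x : Fin n → I), x (Fin.last n))) S
      = ∑' j, D.mass j {x | (fun i => D.gen (x i), D.gen (D.r j - ∑ i, x i)) ∈ S} := by
        rw [Measure.map_apply hsplit hS, D.law_apply (hsplit hS)]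
        refine tsum_congr fun j => congrArg _ ?_
        ext x
        simp [point]
    _ = ∑' j, ∫⁻ x in {x | ∀ i, 0 ≤ x i}, D.tailWeight j (∑ i, x i) *
          S.indicator 1 (fun i => D.gen (x i), D.gen (D.r j - ∑ i, x i)) ∂(simplexMeasure n) := by
        refine tsum_congr fun j => ?_
        rw [← D.lintegral_mass j (hind j)]
        exact (lintegral_indicator_one (hpt j hS)).symm
    _ = ∫⁻ x in {x | ∀ i, 0 ≤ x i}, ∑' j, D.tailWeight j (∑ i, x i) *
          S.indicator 1 (fun i => D.gen (x i), D.gen (D.r j - ∑ i, x i)) ∂(simplexMeasure n) :=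
        (lintegral_tsum fun j =>
          (((D.measurable_tailWeight j).comp hsum).mul (hind j)).aemeasurable).symm
    _ = ∫⁻ x in {x | ∀ i, 0 ≤ x i}, ∑' j, D.tailWeight j (∑ i, x i) *
          D.lastKernel (fun i => D.gen (x i)) (Prod.mk (fun i => D.gen (x i)) ⁻¹' S)
          ∂(simplexMeasure n) := by
        refine setLIntegral_congr_fun hP fun x hx => ?_
        rw [ENNReal.tsum_mul_right, lastKernel_apply,
          Measure.sum_apply _ (measurable_prodMk_left hS), ← ENNReal.tsum_mul_left]
        refine tsum_congr fun j => ?_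
        rw [D.level_gen hx, Measure.smul_apply, smul_eq_mul, ← mul_assoc, ← tailMass,
          D.tailMass_mul_condWeight, Measure.dirac_apply' _ (measurable_prodMk_left hS)]
        rfl
    _ = ∑' j, ∫⁻ x, D.lastKernel (fun i => D.gen (x i)) (Prod.mk (fun i => D.gen (x i)) ⁻¹' S)
          ∂(D.mass j) := by
        have hc := hK.comp D.measurable_gen_comp
        exact (lintegral_tsum fun j =>
          (((D.measurable_tailWeight j).comp hsum).mul hc).aemeasurable).trans
          (tsum_congr fun j => (D.lintegral_mass j hc).symm)
    _ = (firstMarginal D.law ⊗ₘ D.lastKernel) S := by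
        rw [Measure.compProd_apply hS, D.firstMarginal_law, lintegral_sum_measure]
        exact tsum_congr fun j => (lintegral_map hK D.measurable_gen_comp).symm

theorem ae_eq_lastKernel {K : Kernel (Fin n → I) I} (hK : IsMarkovKernelOf K D.law) :
    ∀ᵐ u ∂(firstMarginal D.law), K u = D.lastKernel u := by
  have := hK.1
  exact Kernel.ae_eq_of_compProd_eq (hK.2.symm.trans D.isMarkovKernelOf_lastKernel.2)

theorem strictMono_lastKernel (u : Fin n → I) :
    StrictMono fun y => (D.lastKernel u).real (Iic y) := by
  refine strictMono_of_discrete (D.lastKernel_apply u) fun y z hyz => ?_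
  obtain ⟨j, hj, h1, h2⟩ := D.exists_atom_between (D.level_nonneg u) hyz
  refine ⟨j, ?_, h1, h2.le⟩
  refine mul_ne_zero (ENNReal.inv_ne_zero.2 (D.tailMass_ne_top _)) ?_
  simp [tailWeight, hj.le, D.c_pos j]

theorem isStepFunction_lastKernel (u : Fin n → I) :
    IsStepFunction fun y => (D.lastKernel u).real (Iic y) :=
  isStepFunction_of_discrete (D.lastKernel_apply u)

end DenseAtoms

/-! ### Conclusion -/

/-- Here the dimension is `d = n + 1 ≥ 3`. -/
theorem mainTheorem8 (n : ℕ) (hn : 2 ≤ n) :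
    ∃ (C : (Fin (n + 1) → I) → I) (μ : Measure (Fin (n + 1) → I)),
      IsArchimedeanCopulaWithMeasure C μ ∧
      (μ ⟂ₘ (volume : Measure (Fin (n + 1) → I)) ∧ (∀ x, μ {x} = 0) ∧ μ.support = univ) ∧
      (∀ K : Kernel (Fin n → I) I, IsMarkovKernelOf K μ →
        ∀ᵐ x ∂(firstMarginal μ),
          StrictMono (fun y : I => (K x).real (Iic y)) ∧
          IsStepFunction (fun y : I => (K x).real (Iic y))) ∧
      (∃ Q : Set I, Q ⊆ Ioo 0 1 ∧ Q.Countable ∧ Ioo 0 1 ⊆ closure Q ∧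
        ∀ t : I, 0 < μ (levelSet C t) ↔ t ∈ Q) ∧
      (StrictMono (kendallFunction C μ) ∧ IsStepFunction (kendallFunction C μ)) := by
  have : NeZero n := ⟨by omega⟩
  obtain ⟨D⟩ := nonempty_denseAtoms (NeZero.ne n)
  have := D.isOpenPosMeasure_law
  refine ⟨D.copula, D.law, D.isArchimedeanCopula_law,
    ⟨D.mutuallySingular_law, D.law_singleton, Measure.support_eq_univ⟩, fun K hK => ?_,
    ⟨range fun j => D.gen (D.r j), range_subset_iff.2 D.gen_r_mem_Ioo, countable_range _,
      D.Ioo_subset_closure_range, D.law_levelSet_pos_iff⟩,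
    D.strictMono_kendallFunction, D.isStepFunction_kendallFunction⟩
  filter_upwards [D.ae_eq_lastKernel hK] with u hu
  rw [hu]
  exact ⟨D.strictMono_lastKernel u, D.isStepFunction_lastKernel u⟩
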